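/- Conventions. A uniform space $(X,\mathcal U)$ is Hausdorff, and $\mathcal U$ is the set of its symmetric entourages, directed by reverse inclusion ($U\le V$ iff $U\supseteq V$); $\mathcal U^\omega$ is the set of sequences in $\mathcal U$ with the coordinatewise order. For a directed preordered set $P$, $\mathrm{add}(P)$ is the least cardinality of a subset of $P$ without upper bound, and $\mathrm{add}(P)=1$ if $P$ has a largest element. For directed preordered sets, $P\le_T Q$ means that there is a map $Q\to P$ that sends cofinal subsets of $Q$ to cofinal subsets of $P$, and $P=_T Q$ (Tukey equivalence) means $P\le_T Q$ and $Q\le_T P$. For a cardinal $\tau$, $(X,\mathcal U)$ is $\tau$-precompact if for every $U\in\mathcal U$ there is $A\subseteq X$ with $|A|<\tau$ and $X=\bigcup_{a\in A}\{x:(a,x)\in U\}$. The free topological group $F(X,\mathcal U)$ is the free group on $X$ with the finest group topology for which the canonical map $X\to F(X,\mathcal U)$ is uniformly continuous with respect to the two-sided uniformity of the group (the coarsest uniformity finer than the left and the right one); equivalently, this map is uniformly continuous and every uniformly continuous map from $X$ to a topological group with its two-sided uniformity extends uniquely to a continuous homomorphism on $F(X,\mathcal U)$. $\mathcal N_e(F(X,\mathcal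 U))$ is the set of all neighbourhoods of the identity, ordered by reverse inclusion. Theorem. Let $(X,\mathcal U)$ be a uniform space. (1) If $\mathcal U$ is not the discrete uniformity (that is, the diagonal is not an entourage) and $(X,\mathcal U)$ is $\mathrm{add}(\mathcal U)$-precompact, then $\mathcal N_e(F(X,\mathcal U))=_T\mathcal U^\omega$. (2) In particular, if $X$ is compact, then $\mathcal N_e(F(X,\mathcal U))=_T\mathcal U^\omega$. -/

import Mathlib

open Set Filter Topology Uniformity Cardinal

universe u v

/-! ### Directed preorders, additivity, Tukey order -/

open Classical in
/-- The additivity of a preorder `P`: the least cardinality of an unbounded subset of `P`, and `1`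
if `P` has no unbounded subset (i.e. `P` has a largest element). `BddAbove A` says that `A` is
dominated by a single point. -/
noncomputable def additivity (P : Type u) [Preorder P] : Cardinal.{u} :=
  if ∃ A : Set P, ¬ BddAbove A then sInf {c : Cardinal.{u} | ∃ A : Set P, ¬ BddAbove A ∧ #A = c}
  else 1

/-- `P ≤_T Q`: there is a map `Q → P` sending cofinal subsets of `Q` to cofinal subsets of `P`. -/
def TukeyLE (P : Type u) (Q : Type v) [Preorder P] [Preorder Q] : Prop :=
  ∃ φ : Q → P, ∀ s : Set Q, IsCofinal s → IsCofinal (φ '' s)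

/-- Tukey equivalence `P =_T Q`. -/
def TukeyEquiv (P : Type u) (Q : Type v) [Preorder P] [Preorder Q] : Prop :=
  TukeyLE P Q ∧ TukeyLE Q P

/-- The neighbourhood filter of `x`, ordered by reverse inclusion. -/
abbrev NhdsPoset {G : Type u} [TopologicalSpace G] (x : G) : Type u :=
  {V : Set G // V ∈ 𝓝 x}ᵒᵈ

/-- A uniformity as a poset: the symmetric entourages of `X`, ordered by reverse inclusion. -/
abbrev EntouragePoset (X : Type u) [UniformSpace X] : Type u :=
  {V : Set (X × X) // V ∈ 𝓤 X ∧ ∀ x y, (x, y) ∈ V → (y, x) ∈ V}ᵒᵈ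

/-- `X` is `τ`-precompact: for each entourage `U`, fewer than `τ` many `U`-balls cover `X`. -/
def IsPrecompactCard (X : Type u) [UniformSpace X] (τ : Cardinal.{u}) : Prop :=
  ∀ U ∈ 𝓤 X, ∃ A : Set X, #A < τ ∧ ∀ x : X, ∃ a ∈ A, (a, x) ∈ U

/-! ### The free topological group over a uniform space -/

/-- The two-sided uniformity of a topological group: the coarsest uniformity that is finer than
both the left and the right uniformity. -/
@[reducible] def twoSidedUniformSpace (G : Type u) [Group G] [TopologicalSpace G]
    [IsTopologicalGroup G] : UniformSpace G :=
  IsTopologicalGroup.leftUniformSpace G ⊓ IsTopologicalGroup.rightUniformSpace G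

/-- The map `f` from a uniform space to a topological group is uniformly continuous with respect
to the two-sided uniformity of the group. -/
def UniformContinuousToGroup {X : Type u} {G : Type v} [UniformSpace X] [Group G]
    [TopologicalSpace G] [IsTopologicalGroup G] (f : X → G) : Prop :=
  @UniformContinuous X G _ (twoSidedUniformSpace G) f

/-- The finest group topology on the free group on `X` for which the canonical map from `X` is
uniformly continuous (in Mathlib's order on topologies, finer means smaller). -/
def freeGroupTopology (X : Type u) [UniformSpace X] : GroupTopology (FreeGroup X) :=
  sInf {t : GroupTopology (FreeGroup X) |
    @UniformContinuousToGroup X (FreeGroup X) _ _ t.toTopologicalSpace t.toIsTopologicalGroup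
      FreeGroup.of}

/-- The free topological group `F(X, 𝓤)` over the uniform space `X`. -/
def FreeTopGroup (X : Type u) [UniformSpace X] : Type u := FreeGroup X

namespace FreeTopGroup

instance (X : Type u) [UniformSpace X] : Group (FreeTopGroup X) :=
  inferInstanceAs (Group (FreeGroup X))

instance (X : Type u) [UniformSpace X] : TopologicalSpace (FreeTopGroup X) :=
  (freeGroupTopology X).toTopologicalSpace

instance (X : Type u) [UniformSpace X] : IsTopologicalGroup (FreeTopGroup X) :=
  (freeGroupTopology X).toIsTopologicalGroup

/-- The canonical map from `X` to `F(X, 𝓤)`. -/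
def of {X : Type u} [UniformSpace X] (x : X) : FreeTopGroup X := FreeGroup.of x

end FreeTopGroup

theorem uniformContinuousToGroup_iff {X : Type u} {G : Type v} [UniformSpace X] [Group G]
    [TopologicalSpace G] [IsTopologicalGroup G] (f : X → G) :
    UniformContinuousToGroup f ↔
      Tendsto (fun p : X × X => (f p.1)⁻¹ * f p.2) (𝓤 X) (𝓝 1) ∧
      Tendsto (fun p : X × X => f p.2 * (f p.1)⁻¹) (𝓤 X) (𝓝 1) := by
  exact tendsto_inf.trans (and_congr tendsto_comap_iff tendsto_comap_iff)

/-- The canonical map `X → F(X, 𝓤)` is uniformly continuous. -/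
theorem FreeTopGroup.uniformContinuous_of (X : Type u) [UniformSpace X] :
    UniformContinuousToGroup (FreeTopGroup.of : X → FreeTopGroup X) := by
  rw [uniformContinuousToGroup_iff]
  have h : 𝓝 (1 : FreeTopGroup X) =
      ⨅ t ∈ {t : GroupTopology (FreeGroup X) |
        @UniformContinuousToGroup X (FreeGroup X) _ _ t.toTopologicalSpace t.toIsTopologicalGroup
          FreeGroup.of}, @nhds (FreeGroup X) t.toTopologicalSpace 1 :=
    (nhds_sInf (s := GroupTopology.toTopologicalSpace '' _)).trans iInf_image
  rw [h]
  constructor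
  · refine tendsto_iInf.2 fun t => tendsto_iInf.2 fun ht => ?_
    exact ((@uniformContinuousToGroup_iff X (FreeGroup X) _ _ t.toTopologicalSpace
      t.toIsTopologicalGroup _).1 ht).1
  · refine tendsto_iInf.2 fun t => tendsto_iInf.2 fun ht => ?_
    exact ((@uniformContinuousToGroup_iff X (FreeGroup X) _ _ t.toTopologicalSpace
      t.toIsTopologicalGroup _).1 ht).2

/-- The universal property: each uniformly continuous map from `X` to a topological group extends
uniquely to a continuous homomorphism on `F(X, 𝓤)`. -/
theorem FreeTopGroup.existsUnique_extension {X : Type u} [UniformSpace X] {G : Type v} [Group G]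
    [TopologicalSpace G] [IsTopologicalGroup G] (f : X → G) (hf : UniformContinuousToGroup f) :
    ∃! φ : FreeTopGroup X →* G, Continuous φ ∧ ∀ x, φ (FreeTopGroup.of x) = f x := by
  let φ : FreeGroup X →* G := FreeGroup.lift f
  have hφ : ∀ x, φ (FreeGroup.of x) = f x := fun x => FreeGroup.lift_apply_of
  refine ⟨φ, ⟨?_, hφ⟩, ?_⟩
  · let t : GroupTopology (FreeGroup X) :=
      { toTopologicalSpace := TopologicalSpace.induced φ inferInstance
        toIsTopologicalGroup := topologicalGroup_induced φ }
    have ht : freeGroupTopology X ≤ t := by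
      refine sInf_le ?_
      rw [mem_ofPred_eq, @uniformContinuousToGroup_iff X (FreeGroup X) _ _ t.toTopologicalSpace
        t.toIsTopologicalGroup]
      obtain ⟨h1, h2⟩ := (uniformContinuousToGroup_iff f).1 hf
      have hn : @nhds (FreeGroup X) t.toTopologicalSpace 1 = comap φ (𝓝 1) := by
        have := @nhds_induced G (FreeGroup X) _ φ 1
        rwa [map_one] at this
      rw [hn, tendsto_comap_iff, tendsto_comap_iff]
      simp only [Function.comp_def, map_mul, map_inv, hφ]
      exact ⟨h1, h2⟩
    exact continuous_iff_le_induced.2 ht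
  · rintro ψ ⟨-, hψ⟩
    exact FreeGroup.ext_hom (M := G) ψ φ fun x => (hψ x).trans (hφ x).symm

/-! Both Tukey reductions come from monotone maps with cofinal range.

To bound `𝓤^ω` by the neighbourhoods of `1`, send `V` to the sequence of symmetrized entourages on
which `(x⁻¹y)^(2^n) ∈ V`. This is cofinal by `exists_nhds_pow_mem`: weight separating functions for
`U n` by `2^(-n)`, so that together they map `X` uniformly continuously into one abelian group. The
power `2^n` undoes the weight, so one unit ball controls every `U n`. No precompactness enters here.

Conversely, a double sequence of entourages yields `basicNhd`: products, with distinct indices `i`,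
of conjugates of `x⁻¹y` by words of length `n`, where `(x, y) ∈ U i n`. These sets form a group
filter basis, so they are neighbourhoods of `1`. Small covers make them a base: words of length `n`
form a narrow set, so a single entourage handles all conjugations by them
(`IsNarrow.conj_mem_uniformity`). -/

open scoped SetRel in
/-- Every entourage of a uniform space is an entourage of a uniformly continuous pseudometric. -/
theorem exists_pseudoMetricSpace_of_mem_uniformity {X : Type u} [UniformSpace X] {U : Set (X × X)}
    (hU : U ∈ 𝓤 X) :
    ∃ I : PseudoMetricSpace X, 𝓤 X ≤ 𝓤[I.toUniformSpace] ∧ U ∈ 𝓤[I.toUniformSpace] := by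
  have step : ∀ V : {V : Set (X × X) // V ∈ 𝓤 X}, ∃ W : {V : Set (X × X) // V ∈ 𝓤 X},
      (∀ x y, (x, y) ∈ W.1 → (y, x) ∈ V.1) ∧
        ∀ x y z, (x, y) ∈ W.1 → (y, z) ∈ W.1 → (x, z) ∈ V.1 := by
    rintro ⟨V, hV⟩
    obtain ⟨W, hW, hs, hc⟩ := comp_symm_mem_uniformity_sets hV
    refine ⟨⟨W, hW⟩, fun x y h => ?_, fun x y z h h' => hc ⟨y, h, h'⟩⟩
    exact hc ⟨y, refl_mem_uniformity hW, hs.symm _ _ h⟩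
  choose next hsymm hcomp using step
  -- The iterates of `next` generate a countably generated uniformity coarser than `𝓤 X`, hence a
  -- pseudometrizable one.
  let O : ℕ → {V : Set (X × X) // V ∈ 𝓤 X} := fun n => next^[n] ⟨U, hU⟩
  have hO : ∀ n, O (n + 1) = next (O n) := fun n => Function.iterate_succ_apply' _ _ _
  let F : Filter (X × X) := ⨅ n, 𝓟 (O n).1
  have hF : ∀ n, (O n).1 ∈ F := fun n => mem_iInf_of_mem n (mem_principal_self _)
  have hle : 𝓤 X ≤ F := le_iInf fun n => le_principal_iff.2 (O n).2
  let c : UniformSpace.Core X :=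
    { uniformity := F
      refl := refl_le_uniformity.trans hle
      symm := tendsto_iInf.2 fun n => tendsto_principal.2 <| by
        filter_upwards [hF (n + 1)] with p hp
        rw [hO] at hp
        exact hsymm _ _ _ hp
      comp := le_iInf fun n => le_principal_iff.2 <|
        (mem_lift'_sets (monotone_id.relComp monotone_id)).2 ⟨_, hF (n + 1), by
          rintro ⟨x, z⟩ ⟨y, h, h'⟩
          rw [hO] at h h'
          exact hcomp _ _ _ _ h h'⟩ }
  let 𝒱 : UniformSpace X := UniformSpace.ofCore c
  have : IsCountablyGenerated 𝓤[𝒱] := inferInstanceAs (IsCountablyGenerated (⨅ n, 𝓟 (O n).1))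
  obtain ⟨I, hI⟩ := @UniformSpace.metrizable_uniformity X 𝒱 this
  refine ⟨I, ?_, ?_⟩
  · rw [hI]; exact hle
  · rw [hI]; exact hF 0

/-- For each entourage `U` there is a uniformly equicontinuous family of functions `f · z` with
values in `[0, 1]`, vanishing at `z` and equal to `1` off the `U`-ball of `z`. -/
theorem exists_equicontinuous_separating {X : Type u} [UniformSpace X] {U : Set (X × X)}
    (hU : U ∈ 𝓤 X) :
    ∃ f : X → X → ℝ, (∀ x, f x x = 0) ∧ (∀ x z, 0 ≤ f x z) ∧ (∀ x z, f x z ≤ 1) ∧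
      (∀ x z, (x, z) ∉ U → f x z = 1) ∧
      ∀ ε > 0, ∀ᶠ p in 𝓤 X, ∀ z, |f p.1 z - f p.2 z| < ε := by
  obtain ⟨I, hle, hUI⟩ := exists_pseudoMetricSpace_of_mem_uniformity hU
  obtain ⟨δ, hδ, hδU⟩ := Metric.mem_uniformity_dist.1 hUI
  refine ⟨fun x z => min (dist x z / δ) 1, fun x => by simp, fun x z => by positivity,
    fun x z => min_le_right _ _, fun x z h => ?_, fun ε hε => ?_⟩
  · refine min_eq_right ?_
    rw [le_div_iff₀ hδ, one_mul]
    exact not_lt.1 fun h' => h (hδU h')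
  · filter_upwards [hle (Metric.dist_mem_uniformity (mul_pos hε hδ))] with p hp z
    refine (abs_min_sub_min_le_max _ _ _ _).trans_lt ?_
    rw [sub_self, abs_zero, max_eq_left (abs_nonneg _), ← sub_div, abs_div, abs_of_pos hδ,
      div_lt_iff₀ hδ]
    exact (abs_dist_sub_le _ _ _).trans_lt hp

/-! ### Sequences of entourages coded by neighbourhoods of the identity -/

theorem TukeyLE.of_monotone {P : Type u} {Q : Type v} [Preorder P] [Preorder Q] (φ : Q → P)
    (hφ : Monotone φ) (hc : ∀ p, ∃ q, p ≤ φ q) : TukeyLE P Q := by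
  refine ⟨φ, fun s hs p => ?_⟩
  obtain ⟨q, hq⟩ := hc p
  obtain ⟨r, hr, hqr⟩ := hs q
  exact ⟨φ r, mem_image_of_mem φ hr, hq.trans (hφ hqr)⟩

theorem FreeTopGroup.tendsto_inv_mul (X : Type u) [UniformSpace X] :
    Tendsto (fun p : X × X => (of p.1)⁻¹ * of p.2) (𝓤 X) (𝓝 (1 : FreeTopGroup X)) :=
  ((uniformContinuousToGroup_iff _).1 (uniformContinuous_of X)).1

theorem FreeTopGroup.tendsto_mul_inv (X : Type u) [UniformSpace X] :
    Tendsto (fun p : X × X => of p.2 * (of p.1)⁻¹) (𝓤 X) (𝓝 (1 : FreeTopGroup X)) :=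
  ((uniformContinuousToGroup_iff _).1 (uniformContinuous_of X)).2

/-- A sequence of entourages is coded by a single neighbourhood of the identity. -/
theorem FreeTopGroup.exists_nhds_pow_mem {X : Type u} [UniformSpace X] (U : ℕ → Set (X × X))
    (hU : ∀ n, U n ∈ 𝓤 X) :
    ∃ V ∈ 𝓝 (1 : FreeTopGroup X), ∀ n x y, ((of x)⁻¹ * of y) ^ 2 ^ n ∈ V → (x, y) ∈ U n := by
  choose f hf0 hfn hf1 hfU hfc using fun n => exists_equicontinuous_separating (hU n)
  let G := Multiplicative (UniformFun (ℕ × X) ℝ)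
  let F : X → UniformFun (ℕ × X) ℝ := fun x => UniformFun.ofFun fun p => (1 / 2) ^ p.1 * f p.1 x p.2
  have hb : (𝓝 (0 : UniformFun (ℕ × X) ℝ)).HasBasis (fun ε : ℝ => 0 < ε) fun ε =>
      {g | ∀ p, UniformFun.toFun g p ∈ Metric.ball 0 ε} :=
    UniformFun.hasBasis_nhds_zero_of_basis Metric.nhds_basis_ball
  have hF : Tendsto (fun p : X × X => F p.2 - F p.1) (𝓤 X) (𝓝 0) := by
    refine hb.tendsto_right_iff.2 fun ε hε => ?_
    -- Below `N`, equicontinuity of finitely many families suffices; from `N` on, the weight alone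
    -- is less than `ε`.
    obtain ⟨N, hN⟩ := exists_pow_lt_of_lt_one hε (by norm_num : (1 / 2 : ℝ) < 1)
    have hfin : ∀ᶠ p in 𝓤 X, ∀ n ∈ Finset.range N, ∀ z, |f n p.1 z - f n p.2 z| < ε :=
      (Filter.eventually_all_finset _).2 fun n _ => hfc n ε hε
    filter_upwards [hfin] with p hp
    rintro ⟨n, z⟩
    have e : UniformFun.toFun (F p.2 - F p.1) (n, z) = (1 / 2) ^ n * (f n p.2 z - f n p.1 z) := by
      rw [mul_sub]; rfl
    rw [mem_ball_zero_iff, e, Real.norm_eq_abs, abs_mul, abs_of_pos (by positivity)]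
    by_cases hn : n < N
    · have h1 : (1 / 2 : ℝ) ^ n ≤ 1 := pow_le_one₀ (by norm_num) (by norm_num)
      have h2 := hp n (Finset.mem_range.2 hn) z
      rw [abs_sub_comm] at h2
      exact (mul_le_of_le_one_left (abs_nonneg _) h1).trans_lt h2
    · have h1 : (1 / 2 : ℝ) ^ n ≤ (1 / 2) ^ N :=
        pow_le_pow_of_le_one (by norm_num) (by norm_num) (not_lt.1 hn)
      have h2 : |f n p.2 z - f n p.1 z| ≤ 1 := abs_sub_le_iff.2
        ⟨by linarith [hf1 n p.2 z, hfn n p.1 z], by linarith [hf1 n p.1 z, hfn n p.2 z]⟩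
      exact (mul_le_of_le_one_right (by positivity) h2).trans_lt (h1.trans_lt hN)
  have hF' : UniformContinuousToGroup fun x => (Multiplicative.ofAdd (F x) : G) := by
    rw [uniformContinuousToGroup_iff]
    exact ⟨hF.congr fun p => (neg_add_eq_sub (F p.1) (F p.2)).symm,
      hF.congr fun p => sub_eq_add_neg (F p.2) (F p.1)⟩
  obtain ⟨φ, ⟨hφ, hφof⟩, -⟩ := existsUnique_extension _ hF'
  refine ⟨φ ⁻¹' {g : G | ∀ p, UniformFun.toFun (Multiplicative.toAdd g) p ∈ Metric.ball 0 1},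
    hφ.continuousAt.preimage_mem_nhds ?_, fun n x y h => ?_⟩
  · rw [map_one]
    exact hb.mem_of_mem one_pos
  · by_contra hxy
    -- At the coordinate `(n, y)` the function of `y` vanishes and that of `x` equals the full
    -- weight, so the `2^n`-th power has value `-1`, outside the unit ball.
    have h' := h (n, y)
    have e : UniformFun.toFun (Multiplicative.toAdd (φ (((of x)⁻¹ * of y) ^ 2 ^ n))) (n, y) =
        2 ^ n * ((1 / 2) ^ n * f n y y - (1 / 2) ^ n * f n x y) := by
      rw [map_pow, map_mul, map_inv, hφof, hφof, toAdd_pow, toAdd_mul, toAdd_inv, toAdd_ofAdd,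
        toAdd_ofAdd, neg_add_eq_sub]
      change (2 ^ n) • ((1 / 2) ^ n * f n y y - (1 / 2) ^ n * f n x y) = _
      rw [nsmul_eq_mul]; push_cast; rfl
    rw [e, hf0, hfU n x y hxy, mem_ball_zero_iff] at h'
    have e2 : (2 : ℝ) ^ n * ((1 / 2) ^ n * 0 - (1 / 2) ^ n * 1) = -1 := by
      rw [mul_zero, mul_one, zero_sub, mul_neg, ← mul_pow]; norm_num
    rw [e2] at h'
    norm_num at h'

theorem FreeTopGroup.entourage_pow_tukeyLE (X : Type u) [UniformSpace X] :
    TukeyLE (ℕ → EntouragePoset X) (NhdsPoset (1 : FreeTopGroup X)) := by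
  have key : ∀ V ∈ 𝓝 (1 : FreeTopGroup X), ∀ n : ℕ,
      {p : X × X | ((of p.1)⁻¹ * of p.2) ^ 2 ^ n ∈ V} ∈ 𝓤 X := fun V hV n => by
    have h := (tendsto_inv_mul X).pow (2 ^ n)
    rw [one_pow] at h
    exact h hV
  let φ : NhdsPoset (1 : FreeTopGroup X) → ℕ → EntouragePoset X := fun V n => OrderDual.toDual
    ⟨{p | ((of p.1)⁻¹ * of p.2) ^ 2 ^ n ∈ (OrderDual.ofDual V).1} ∩
      Prod.swap ⁻¹' {p | ((of p.1)⁻¹ * of p.2) ^ 2 ^ n ∈ (OrderDual.ofDual V).1},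
      inter_mem (key _ (OrderDual.ofDual V).2 n)
        (tendsto_swap_uniformity (key _ (OrderDual.ofDual V).2 n)), fun x y h => ⟨h.2, h.1⟩⟩
  refine TukeyLE.of_monotone φ (fun V W h n p hp => ⟨h hp.1, h hp.2⟩) fun u => ?_
  obtain ⟨V, hV, hVu⟩ := exists_nhds_pow_mem (fun n => (OrderDual.ofDual (u n)).1)
    fun n => (OrderDual.ofDual (u n)).2.1
  exact ⟨OrderDual.toDual ⟨V, hV⟩, fun n p hp => hVu n _ _ hp.1⟩

open scoped Pointwise

/-! ### Products with distinct indices -/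

/-- All products, in any order, of elements of sets `E i` with pairwise distinct indices. -/
def distinctProducts {G : Type u} [Group G] (E : ℕ → Set G) : Set G :=
  {g | ∃ L : List (ℕ × G), (L.map Prod.fst).Nodup ∧ (∀ q ∈ L, q.2 ∈ E q.1) ∧
    (L.map Prod.snd).prod = g}

section distinctProducts

variable {G : Type u} [Group G] {E E' : ℕ → Set G}

theorem distinctProducts_mono (h : ∀ i, E i ⊆ E' i) : distinctProducts E ⊆ distinctProducts E' := by
  rintro g ⟨L, hn, hE, rfl⟩
  exact ⟨L, hn, fun q hq => h _ (hE q hq), rfl⟩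

theorem one_mem_distinctProducts : (1 : G) ∈ distinctProducts E := ⟨[], by simp⟩

theorem subset_distinctProducts (i : ℕ) : E i ⊆ distinctProducts E := fun g hg =>
  ⟨[(i, g)], by simp, by simpa using hg, by simp⟩

theorem image_distinctProducts_subset (f : G →* G) (h : ∀ i, ∀ g ∈ E i, f g ∈ E' i) {g : G}
    (hg : g ∈ distinctProducts E) : f g ∈ distinctProducts E' := by
  obtain ⟨L, hn, hE, rfl⟩ := hg
  refine ⟨L.map (Prod.map id f), by simpa [List.map_map, Function.comp_def] using hn, ?_, ?_⟩
  · intro q hq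
    obtain ⟨p, hp, rfl⟩ := List.mem_map.1 hq
    exact h _ _ (hE p hp)
  · rw [map_list_prod, List.map_map, List.map_map]; rfl

theorem inv_mem_distinctProducts (h : ∀ i, ∀ g ∈ E i, g⁻¹ ∈ E i) {g : G}
    (hg : g ∈ distinctProducts E) : g⁻¹ ∈ distinctProducts E := by
  obtain ⟨L, hn, hE, rfl⟩ := hg
  refine ⟨(L.map (Prod.map id (·⁻¹))).reverse, ?_, ?_, ?_⟩
  · rw [List.map_reverse, List.nodup_reverse, List.map_map]; exact hn
  · intro q hq
    obtain ⟨p, hp, rfl⟩ := List.mem_map.1 (List.mem_reverse.1 hq)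
    exact h _ _ (hE p hp)
  · rw [List.prod_inv_reverse, List.map_reverse, List.map_map, List.map_map]; rfl

/-- Products from even- and odd-indexed sets combine. -/
theorem mul_mem_distinctProducts {g h : G} (hg : g ∈ distinctProducts fun i => E (2 * i))
    (hh : h ∈ distinctProducts fun i => E (2 * i + 1)) : g * h ∈ distinctProducts E := by
  obtain ⟨L, hL, hLE, rfl⟩ := hg
  obtain ⟨M, hM, hME, rfl⟩ := hh
  refine ⟨L.map (Prod.map (2 * ·) id) ++ M.map (Prod.map (2 * · + 1) id), ?_, ?_, ?_⟩
  · rw [List.map_append, List.map_map, List.map_map, List.nodup_append]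
    have e1 : L.map (Prod.fst ∘ Prod.map (2 * ·) id) = (L.map Prod.fst).map (2 * ·) := by
      rw [List.map_map]; rfl
    have e2 : M.map (Prod.fst ∘ Prod.map (2 * · + 1) id) = (M.map Prod.fst).map (2 * · + 1) := by
      rw [List.map_map]; rfl
    rw [e1, e2]
    refine ⟨hL.map fun a b h => by simpa using h, hM.map fun a b h => by simpa using h, ?_⟩
    intro a ha b hb
    obtain ⟨i, -, rfl⟩ := List.mem_map.1 ha
    obtain ⟨j, -, rfl⟩ := List.mem_map.1 hb
    omega
  · intro q hq
    rcases List.mem_append.1 hq with hq | hq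
    · obtain ⟨p, hp, rfl⟩ := List.mem_map.1 hq
      exact hLE p hp
    · obtain ⟨p, hp, rfl⟩ := List.mem_map.1 hq
      exact hME p hp
  · rw [List.map_append, List.prod_append, List.map_map, List.map_map]; rfl

/-- The least possible index `k` occurs at most once. Splitting there leaves two products with
indices above `k`, each in `V (k + 1)` by induction, around a factor in `V (k + 1)`; order is
irrelevant. -/
theorem distinctProducts_subset {V : ℕ → Set G} (h1 : ∀ i, 1 ∈ V i)
    (hV : ∀ i, V (i + 1) * V (i + 1) * V (i + 1) ⊆ V i) :
    (distinctProducts fun i => V (i + 1)) ⊆ V 0 := by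
  have key : ∀ (d k : ℕ) (L : List (ℕ × G)), (L.map Prod.fst).Nodup →
      (∀ q ∈ L, k ≤ q.1 ∧ q.1 < k + d ∧ q.2 ∈ V (q.1 + 1)) → (L.map Prod.snd).prod ∈ V k := by
    intro d
    induction d with
    | zero =>
      intro k L _ hL
      rcases L with _ | ⟨q, L⟩
      · simpa using h1 k
      · have := hL q List.mem_cons_self
        omega
    | succ d ih =>
      intro k L hn hL
      by_cases hk : ∃ q ∈ L, q.1 = k
      · obtain ⟨⟨k, g⟩, hq, rfl⟩ := hk
        obtain ⟨A, B, rfl⟩ := List.append_of_mem hq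
        rw [List.map_append, List.map_cons, List.nodup_append] at hn
        obtain ⟨hA, hB, hAB⟩ := hn
        rw [List.nodup_cons] at hB
        rw [List.map_append, List.map_cons, List.prod_append, List.prod_cons, ← mul_assoc]
        refine hV k (mul_mem_mul (mul_mem_mul (ih _ A hA fun q hq => ?_) ?_)
          (ih _ B hB.2 fun q hq => ?_))
        · have h := hL q (List.mem_append_left _ hq)
          have hne : q.1 ≠ k := hAB _ (List.mem_map_of_mem hq) _ List.mem_cons_self
          dsimp only at h
          exact ⟨by omega, by omega, h.2.2⟩
        · exact (hL (k, g) hq).2.2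
        · have h := hL q (List.mem_append_right _ (List.mem_cons_of_mem _ hq))
          have hne : q.1 ≠ k := fun e => hB.1 (List.mem_map.2 ⟨q, hq, e⟩)
          dsimp only at h
          exact ⟨by omega, by omega, h.2.2⟩
      · have h := ih (k + 1) L hn fun q hq => by
          have h := hL q hq
          have hne : q.1 ≠ k := fun e => hk ⟨q, hq, e⟩
          exact ⟨by omega, by omega, h.2.2⟩
        refine hV k ?_
        simpa using mul_mem_mul (mul_mem_mul h (h1 (k + 1))) (h1 (k + 1))
  rintro g ⟨L, hn, hL, rfl⟩
  obtain ⟨b, hb⟩ : ∃ b, ∀ q ∈ L, q.1 < b := by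
    refine ⟨(L.map Prod.fst).sum + 1, fun q hq => Nat.lt_succ_of_le ?_⟩
    exact List.le_sum_of_mem (List.mem_map_of_mem hq)
  exact key b 0 L hn fun q hq => ⟨Nat.zero_le _, by simpa using hb q hq, hL q hq⟩

end distinctProducts

/-! ### Neighbourhoods of the identity of `F(X, 𝓤)` coming from sequences of entourages -/

namespace FreeTopGroup

variable {X : Type u} [UniformSpace X]

/-- The set of letters and their inverses, together with the identity. -/
def letters (X : Type u) [UniformSpace X] : Set (FreeTopGroup X) :=
  {1} ∪ (range of ∪ (range of)⁻¹)

theorem of_mem_letters (x : X) : of x ∈ letters X := Or.inr (Or.inl ⟨x, rfl⟩)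

theorem inv_of_mem_letters (x : X) : (of x)⁻¹ ∈ letters X := Or.inr (Or.inr (by simp))

theorem exists_mem_letters_pow (g : FreeTopGroup X) : ∃ n, g ∈ letters X ^ n := by
  refine FreeGroup.induction_on (C := fun g : FreeGroup X =>
    ∃ n, (show FreeTopGroup X from g) ∈ letters X ^ n) g ⟨0, by simp; rfl⟩
    (fun x => ⟨1, (pow_one (letters X)).symm ▸ of_mem_letters x⟩)
    (fun x _ => ⟨1, (pow_one (letters X)).symm ▸ inv_of_mem_letters x⟩) ?_
  rintro g h ⟨m, hm⟩ ⟨n, hn⟩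
  exact ⟨m + n, pow_add (letters X) m n ▸ mul_mem_mul hm hn⟩

/-- The conjugates by words of length `n` of the differences `x⁻¹ y` with `(x, y) ∈ U n`. -/
def conjDiffs (U : ℕ → Set (X × X)) : Set (FreeTopGroup X) :=
  {h | ∃ n, ∃ g ∈ letters X ^ n, ∃ x y, (x, y) ∈ U n ∧ h = g⁻¹ * ((of x)⁻¹ * of y) * g}

theorem conjDiffs_mono {U V : ℕ → Set (X × X)} (h : ∀ n, U n ⊆ V n) :
    conjDiffs U ⊆ conjDiffs V := by
  rintro _ ⟨n, g, hg, x, y, hxy, rfl⟩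
  exact ⟨n, g, hg, x, y, h n hxy, rfl⟩

theorem inv_mem_conjDiffs {U : ℕ → Set (X × X)} (h : ∀ n x y, (x, y) ∈ U n → (y, x) ∈ U n)
    {g : FreeTopGroup X} (hg : g ∈ conjDiffs U) : g⁻¹ ∈ conjDiffs U := by
  obtain ⟨n, g, hg, x, y, hxy, rfl⟩ := hg
  exact ⟨n, g, hg, y, x, h n x y hxy, by group⟩

/-- Conjugation by `a` lengthens the conjugating words by `m`, which a shift of the sequence
absorbs. -/
theorem conj_mem_conjDiffs {U : ℕ → Set (X × X)} {m : ℕ} {a : FreeTopGroup X}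
    (ha : a⁻¹ ∈ letters X ^ m) {g : FreeTopGroup X} (hg : g ∈ conjDiffs fun n => U (n + m)) :
    a * g * a⁻¹ ∈ conjDiffs U := by
  obtain ⟨n, g, hg, x, y, hxy, rfl⟩ := hg
  exact ⟨n + m, g * a⁻¹, pow_add (letters X) n m ▸ mul_mem_mul hg ha, x, y, hxy, by group⟩

/-- The basic neighbourhood of the identity given by a double sequence of entourages. -/
def basicNhd (U : ℕ → ℕ → Set (X × X)) : Set (FreeTopGroup X) :=
  distinctProducts fun i => conjDiffs (U i)

theorem basicNhd_mono {U V : ℕ → ℕ → Set (X × X)} (h : ∀ i n, U i n ⊆ V i n) :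
    basicNhd U ⊆ basicNhd V :=
  distinctProducts_mono fun i => conjDiffs_mono (h i)

/-- The group filter basis on the free group formed by the sets `basicNhd U`. -/
@[reducible] def groupFilterBasis (X : Type u) [UniformSpace X] :
    GroupFilterBasis (FreeGroup X) where
  sets := {W | ∃ U : ℕ → ℕ → Set (X × X), (∀ i n, U i n ∈ 𝓤 X) ∧
    (∀ i n x y, (x, y) ∈ U i n → (y, x) ∈ U i n) ∧ basicNhd U = W}
  nonempty := ⟨_, fun _ _ => univ, fun _ _ => univ_mem, fun _ _ _ _ _ => mem_univ _, rfl⟩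
  inter_sets := by
    rintro _ _ ⟨U, hU, hUs, rfl⟩ ⟨V, hV, hVs, rfl⟩
    exact ⟨_, ⟨fun i n => U i n ∩ V i n, fun i n => inter_mem (hU i n) (hV i n),
      fun i n x y h => ⟨hUs _ _ _ _ h.1, hVs _ _ _ _ h.2⟩, rfl⟩,
      subset_inter (basicNhd_mono fun _ _ => inter_subset_left)
        (basicNhd_mono fun _ _ => inter_subset_right)⟩
  one' := by
    rintro _ ⟨U, -, -, rfl⟩
    exact one_mem_distinctProducts (G := FreeTopGroup X)
  mul' := by
    rintro _ ⟨U, hU, hUs, rfl⟩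
    refine ⟨_, ⟨fun i n => U (2 * i) n ∩ U (2 * i + 1) n, fun i n => inter_mem (hU _ n) (hU _ n),
      fun i n x y h => ⟨hUs _ _ _ _ h.1, hUs _ _ _ _ h.2⟩, rfl⟩, ?_⟩
    rintro _ ⟨g, hg, h, hh, rfl⟩
    exact mul_mem_distinctProducts (G := FreeTopGroup X) (E := fun i => conjDiffs (U i))
      (basicNhd_mono (fun _ _ => inter_subset_left) hg)
      (basicNhd_mono (fun _ _ => inter_subset_right) hh)
  inv' := by
    rintro _ ⟨U, hU, hUs, rfl⟩
    exact ⟨_, ⟨U, hU, hUs, rfl⟩, fun g hg => inv_mem_distinctProducts (G := FreeTopGroup X)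
      (fun i g hg => inv_mem_conjDiffs (hUs i) hg) hg⟩
  conj' := by
    rintro a _ ⟨U, hU, hUs, rfl⟩
    obtain ⟨m, hm⟩ := exists_mem_letters_pow (X := X) a⁻¹
    refine ⟨_, ⟨fun i n => U i (n + m), fun i n => hU _ _, fun i n => hUs _ _, rfl⟩,
      fun g hg => ?_⟩
    refine image_distinctProducts_subset (G := FreeTopGroup X) (E' := fun i => conjDiffs (U i))
      (MulAut.conj a).toMonoidHom (fun i g hg => conj_mem_conjDiffs hm hg) hg

/-- The basis defines a group topology making `X → F(X)` uniformly continuous, so the free topology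
is finer. -/
theorem basicNhd_mem_nhds {U : ℕ → ℕ → Set (X × X)} (hU : ∀ i n, U i n ∈ 𝓤 X)
    (hs : ∀ i n x y, (x, y) ∈ U i n → (y, x) ∈ U i n) :
    basicNhd U ∈ 𝓝 (1 : FreeTopGroup X) := by
  let t : GroupTopology (FreeGroup X) :=
    { toTopologicalSpace := (groupFilterBasis X).topology
      toIsTopologicalGroup := (groupFilterBasis X).isTopologicalGroup }
  have hb := (groupFilterBasis X).nhds_one_hasBasis
  have ht : freeGroupTopology X ≤ t := by
    refine sInf_le ?_
    rw [mem_ofPred_eq, @uniformContinuousToGroup_iff X (FreeGroup X) _ _ t.toTopologicalSpace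
      t.toIsTopologicalGroup]
    constructor
    · refine hb.tendsto_right_iff.2 ?_
      rintro _ ⟨V, hV, -, rfl⟩
      filter_upwards [hV 0 0] with p hp
      exact subset_distinctProducts (G := FreeTopGroup X) (E := fun i => conjDiffs (V i)) 0
        ⟨0, 1, by simp, p.1, p.2, hp, by group; rfl⟩
    · refine hb.tendsto_right_iff.2 ?_
      rintro _ ⟨V, hV, -, rfl⟩
      filter_upwards [hV 0 1] with p hp
      exact subset_distinctProducts (G := FreeTopGroup X) (E := fun i => conjDiffs (V i)) 0
        -- Right differences are conjugate to left ones: `y x⁻¹ = x (x⁻¹ y) x⁻¹`, a word of length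
        -- one.
        ⟨1, (of p.1)⁻¹, by simpa using inv_of_mem_letters p.1, p.1, p.2, hp, by
          change of p.2 * (of p.1)⁻¹ = _
          group⟩
  have hle : 𝓝 (1 : FreeTopGroup X) ≤ @nhds (FreeGroup X) t.toTopologicalSpace 1 :=
    nhds_mono (t₁ := (freeGroupTopology X).toTopologicalSpace) (t₂ := t.toTopologicalSpace) ht
  exact hle (hb.mem_of_mem ⟨U, hU, hs, rfl⟩)

end FreeTopGroup

/-! ### Uniformly small index sets and covers -/

/-- Intersections of `ι`-indexed families of entourages of `X` are entourages. -/
def IsUniformlySmall (X : Type u) [UniformSpace X] (ι : Type u) : Prop :=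
  ∀ f : ι → Set (X × X), (∀ i, f i ∈ 𝓤 X) → ⋂ i, f i ∈ 𝓤 X

namespace IsUniformlySmall

variable {X : Type u} [UniformSpace X] {ι κ : Type u}

theorem of_finite [Finite ι] : IsUniformlySmall X ι := fun _ hf => iInter_mem.2 hf

theorem sigma {κ : ι → Type u} (hι : IsUniformlySmall X ι) (hκ : ∀ i, IsUniformlySmall X (κ i)) :
    IsUniformlySmall X (Σ i, κ i) := fun f hf => by
  rw [iInter_sigma]
  exact hι _ fun i => hκ i _ fun j => hf ⟨i, j⟩

theorem sum (hι : IsUniformlySmall X ι) (hκ : IsUniformlySmall X κ) :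
    IsUniformlySmall X (ι ⊕ κ) := fun f hf => by
  rw [iInter_sum]
  exact inter_mem (hι _ fun i => hf _) (hκ _ fun i => hf _)

theorem of_card_lt_additivity (h : #ι < additivity (EntouragePoset X)) :
    IsUniformlySmall X ι := fun f hf => by
  let g : ι → EntouragePoset X := fun i => OrderDual.toDual
    ⟨SetRel.symmetrize (f i), symmetrize_mem_uniformity (hf i), fun x y h => ⟨h.2, h.1⟩⟩
  have hg : BddAbove (range g) := by
    by_contra hb
    rw [additivity, if_pos ⟨_, hb⟩] at h
    have hle := csInf_le' (s := {c | ∃ A : Set (EntouragePoset X), ¬ BddAbove A ∧ #A = c})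
      ⟨range g, hb, rfl⟩
    exact hle.not_gt (mk_range_le.trans_lt h)
  obtain ⟨W, hW⟩ := hg
  refine mem_of_superset (OrderDual.ofDual W).2.1 (subset_iInter fun i p hp => ?_)
  have : (OrderDual.ofDual W).1 ⊆ SetRel.symmetrize (f i) := hW (mem_range_self i)
  exact (this hp).1

end IsUniformlySmall

/-- Each entourage `U` has a cover by `U`-balls centred at a uniformly small set of points. -/
def HasSmallCovers (X : Type u) [UniformSpace X] : Prop :=
  ∀ U ∈ 𝓤 X, ∃ A : Set X, IsUniformlySmall X A ∧ ∀ x : X, ∃ a ∈ A, (a, x) ∈ U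

theorem IsPrecompactCard.hasSmallCovers {X : Type u} [UniformSpace X]
    (h : IsPrecompactCard X (additivity (EntouragePoset X))) : HasSmallCovers X := fun U hU => by
  obtain ⟨A, hA, hc⟩ := h U hU
  exact ⟨A, .of_card_lt_additivity hA, hc⟩

theorem HasSmallCovers.of_compactSpace (X : Type u) [UniformSpace X] [CompactSpace X] :
    HasSmallCovers X := fun U hU => by
  obtain ⟨A, hA, hc⟩ := (isCompact_univ (X := X)).totallyBounded _ (symm_le_uniformity hU)
  have := hA.to_subtype
  refine ⟨A, .of_finite, fun x => ?_⟩
  simpa using hc (mem_univ x)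

/-! ### Narrow sets, and the base at the identity -/

namespace FreeTopGroup

variable {X : Type u} [UniformSpace X]

/-- `T` is covered by uniformly small families of translates of each neighbourhood of `1`. -/
def IsNarrow (T : Set (FreeTopGroup X)) : Prop :=
  ∀ V ∈ 𝓝 (1 : FreeTopGroup X), ∃ ι : Type u, IsUniformlySmall X ι ∧
    ∃ a : ι → FreeTopGroup X, ∀ t ∈ T, ∃ i, (a i)⁻¹ * t ∈ V

theorem IsNarrow.union {S T : Set (FreeTopGroup X)} (hS : IsNarrow S) (hT : IsNarrow T) :
    IsNarrow (S ∪ T) := fun V hV => by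
  obtain ⟨ι, hι, a, ha⟩ := hS V hV
  obtain ⟨κ, hκ, b, hb⟩ := hT V hV
  refine ⟨ι ⊕ κ, hι.sum hκ, Sum.elim a b, ?_⟩
  rintro t (ht | ht)
  · exact (ha t ht).imp' Sum.inl fun i hi => hi
  · exact (hb t ht).imp' Sum.inr fun i hi => hi

/-- Cover `T` first, by translates with centres `b j`; then cover `S` up to the conjugate of `W` by
each `b j`, since `(ab)⁻¹st = (b⁻¹(a⁻¹s)b)(b⁻¹t)`. -/
theorem IsNarrow.mul {S T : Set (FreeTopGroup X)} (hS : IsNarrow S) (hT : IsNarrow T) :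
    IsNarrow (S * T) := fun V hV => by
  obtain ⟨W, hW, hWV⟩ := exists_nhds_one_split hV
  obtain ⟨κ, hκ, b, hb⟩ := hT W hW
  have hconj : ∀ j, {s | (b j)⁻¹ * s * b j ∈ W} ∈ 𝓝 (1 : FreeTopGroup X) := fun j => by
    have h : Tendsto (fun s => (b j)⁻¹ * s * b j) (𝓝 1) (𝓝 ((b j)⁻¹ * 1 * b j)) :=
      Continuous.tendsto (by fun_prop) 1
    rw [mul_one, inv_mul_cancel] at h
    exact h hW
  choose ι hι a ha using fun j => hS _ (hconj j)
  refine ⟨Σ j, ι j, hκ.sigma hι, fun p => a p.1 p.2 * b p.1, ?_⟩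
  rintro _ ⟨s, hs, t, ht, rfl⟩
  obtain ⟨j, hj⟩ := hb t ht
  obtain ⟨i, hi⟩ := ha j s hs
  refine ⟨⟨j, i⟩, ?_⟩
  have := hWV _ hi _ hj
  convert this using 1
  simp only [mul_inv_rev]
  group

theorem isNarrow_one : IsNarrow (1 : Set (FreeTopGroup X)) := fun V hV =>
  ⟨PUnit, .of_finite, fun _ => 1, by
    rintro _ rfl
    exact ⟨⟨⟩, by simpa using mem_of_mem_nhds hV⟩⟩

theorem isNarrow_letters (hX : HasSmallCovers X) : IsNarrow (letters X) := by
  refine isNarrow_one.union (IsNarrow.union (fun V hV => ?_) fun V hV => ?_)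
  · obtain ⟨A, hA, hc⟩ := hX _ (tendsto_inv_mul X hV)
    refine ⟨A, hA, fun a => of a.1, ?_⟩
    rintro _ ⟨x, rfl⟩
    obtain ⟨a, ha, h⟩ := hc x
    exact ⟨⟨a, ha⟩, h⟩
  · obtain ⟨A, hA, hc⟩ := hX _ (symm_le_uniformity (tendsto_mul_inv X hV))
    refine ⟨A, hA, fun a => (of a.1)⁻¹, fun t ht => ?_⟩
    obtain ⟨x, hx⟩ := ht
    obtain ⟨a, ha, h⟩ := hc x
    refine ⟨⟨a, ha⟩, ?_⟩
    rw [← inv_inv t, ← hx, inv_inv]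
    exact h

theorem IsNarrow.pow {S : Set (FreeTopGroup X)} (hS : IsNarrow S) (n : ℕ) : IsNarrow (S ^ n) := by
  induction n with
  | zero => simpa using isNarrow_one
  | succ n ih => exact pow_succ S n ▸ ih.mul hS

/-- Writing `g = a i * w` with `w` near `1`, conjugation by `g` is conjugation by `a i` followed by
one by `w`. Only the `a i` impose entourages, and these intersect in an entourage. -/
theorem IsNarrow.conj_mem_uniformity {T : Set (FreeTopGroup X)} (hT : IsNarrow T)
    {V : Set (FreeTopGroup X)} (hV : V ∈ 𝓝 1) :
    {p : X × X | ∀ g ∈ T, g⁻¹ * ((of p.1)⁻¹ * of p.2) * g ∈ V} ∈ 𝓤 X := by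
  have h3 : Tendsto (fun q : FreeTopGroup X × FreeTopGroup X => q.2⁻¹ * q.1 * q.2) (𝓝 (1, 1))
      (𝓝 1) := by
    have h : Tendsto (fun q : FreeTopGroup X × FreeTopGroup X => q.2⁻¹ * q.1 * q.2) (𝓝 (1, 1))
      (𝓝 (1⁻¹ * 1 * 1)) := Continuous.tendsto (by fun_prop) (1, 1)
    simpa using h
  obtain ⟨W, hW, W', hW', hWV⟩ := mem_nhds_prod_iff.1 (h3 hV)
  obtain ⟨ι, hι, a, ha⟩ := hT W' hW'
  have hconj : ∀ i, {p : X × X | (a i)⁻¹ * ((of p.1)⁻¹ * of p.2) * a i ∈ W} ∈ 𝓤 X := fun i => by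
    have h : Tendsto (fun s => (a i)⁻¹ * s * a i) (𝓝 1) (𝓝 ((a i)⁻¹ * 1 * a i)) :=
      Continuous.tendsto (by fun_prop) 1
    rw [mul_one, inv_mul_cancel] at h
    exact h.comp (tendsto_inv_mul X) hW
  filter_upwards [hι _ hconj] with p hp g hg
  obtain ⟨i, hi⟩ := ha g hg
  have := hWV (mk_mem_prod (mem_iInter.1 hp i) hi)
  simp only [mem_preimage] at this
  convert this using 1
  group

theorem exists_basicNhd_subset (hX : HasSmallCovers X) {V : Set (FreeTopGroup X)}
    (hV : V ∈ 𝓝 1) :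
    ∃ U : ℕ → ℕ → Set (X × X), (∀ i n, U i n ∈ 𝓤 X) ∧
      (∀ i n x y, (x, y) ∈ U i n → (y, x) ∈ U i n) ∧ basicNhd U ⊆ V := by
  have step : ∀ V : {V : Set (FreeTopGroup X) // V ∈ 𝓝 1},
      ∃ W : {V : Set (FreeTopGroup X) // V ∈ 𝓝 1}, W.1 * W.1 * W.1 ⊆ V.1 := by
    rintro ⟨V, hV⟩
    have h : Tendsto (fun q : FreeTopGroup X × FreeTopGroup X × FreeTopGroup X =>
      q.1 * q.2.1 * q.2.2) (𝓝 (1, 1, 1)) (𝓝 (1 * 1 * 1)) :=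
      Continuous.tendsto (by fun_prop) (1, 1, 1)
    rw [mul_one, mul_one] at h
    obtain ⟨A, hA, B, hB, hAB⟩ := mem_nhds_prod_iff.1 (h hV)
    obtain ⟨C, hC, D, hD, hCD⟩ := mem_nhds_prod_iff.1 hB
    refine ⟨⟨A ∩ (C ∩ D), inter_mem hA (inter_mem hC hD)⟩, ?_⟩
    rintro _ ⟨_, ⟨a, ha, b, hb, rfl⟩, c, hc, rfl⟩
    exact hAB (mk_mem_prod ha.1 (hCD (mk_mem_prod hb.2.1 hc.2.2)))
  choose next hnext using step
  let O : ℕ → {V : Set (FreeTopGroup X) // V ∈ 𝓝 1} := fun n => next^[n] ⟨V, hV⟩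
  have hO : ∀ n, O (n + 1) = next (O n) := fun n => Function.iterate_succ_apply' _ _ _
  -- The shift to `O (i + 1)` matches `distinctProducts_subset`, which places the product in `O 0`,
  -- that is, in `V`.
  have hmem := fun i n => ((isNarrow_letters hX).pow n).conj_mem_uniformity (O (i + 1)).2
  refine ⟨fun i n => SetRel.symmetrize _, fun i n => symmetrize_mem_uniformity (hmem i n),
    fun i n x y h => ⟨h.2, h.1⟩, ?_⟩
  refine Subset.trans (distinctProducts_mono fun i => ?_)
    (distinctProducts_subset (V := fun i => (O i).1) (fun i => mem_of_mem_nhds (O i).2)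
      fun i => by rw [hO]; exact hnext _)
  rintro _ ⟨n, g, hg, x, y, hxy, rfl⟩
  exact hxy.1 g hg

theorem tukeyLE_entourage_pow (hX : HasSmallCovers X) :
    TukeyLE (NhdsPoset (1 : FreeTopGroup X)) (ℕ → EntouragePoset X) := by
  let φ : (ℕ → EntouragePoset X) → NhdsPoset (1 : FreeTopGroup X) := fun u => OrderDual.toDual
    ⟨basicNhd fun i n => (OrderDual.ofDual (u (Nat.pair i n))).1,
      basicNhd_mem_nhds (fun i n => (OrderDual.ofDual (u (Nat.pair i n))).2.1)
        fun i n => (OrderDual.ofDual (u (Nat.pair i n))).2.2⟩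
  refine TukeyLE.of_monotone φ (fun u v h => basicNhd_mono fun i n => h (Nat.pair i n)) fun V => ?_
  obtain ⟨U, hU, hs, hUV⟩ := exists_basicNhd_subset hX (OrderDual.ofDual V).2
  refine ⟨fun k => OrderDual.toDual
    ⟨U k.unpair.1 k.unpair.2, hU _ _, hs _ _⟩, ?_⟩
  refine Subset.trans (?_ : basicNhd (fun i n => U (Nat.pair i n).unpair.1 (Nat.pair i n).unpair.2)
    ⊆ basicNhd U) hUV
  simp only [Nat.unpair_pair, Subset.rfl]

theorem tukeyEquiv_entourage_pow (hX : HasSmallCovers X) :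
    TukeyEquiv (NhdsPoset (1 : FreeTopGroup X)) (ℕ → EntouragePoset X) :=
  ⟨tukeyLE_entourage_pow hX, entourage_pow_tukeyLE X⟩

end FreeTopGroup

theorem theorem3 (X : Type u) [UniformSpace X] [T0Space X] :
    (¬ DiscreteUniformity X → IsPrecompactCard X (additivity (EntouragePoset X)) →
      TukeyEquiv (NhdsPoset (1 : FreeTopGroup X)) (ℕ → EntouragePoset X)) ∧
    (CompactSpace X →
      TukeyEquiv (NhdsPoset (1 : FreeTopGroup X)) (ℕ → EntouragePoset X)) :=
  ⟨fun _ h => FreeTopGroup.tukeyEquiv_entourage_pow h.hasSmallCovers,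
    fun _ => FreeTopGroup.tukeyEquiv_entourage_pow (.of_compactSpace X)⟩
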